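/- For an open interval $J\subseteq\mathbb R$ and a locally integrable $f:J\to\mathbb R$ put $$\|f\|_{BLO(J)}=\sup_{I}\Big(\frac1{|I|}\int_I f\,dx-\inf_I f\Big)\in[0,\infty],$$ where $I$ ranges over the nondegenerate compact intervals contained in $J$ and $\inf_I$ is the essential infimum. Let $BLO(J)$ be the set of locally integrable $f$ on $J$ with $\|f\|_{BLO(J)}<\infty$. For $k\in\mathbb N$ let $T_kf=\max(-k,\min(k,f))$, and put $$T(J)=\{f\in BLO(J):\ \lim_{k\to\infty}\|f-T_kf\|_{BLO(J)}=0\},\qquad \overline{L^\infty(J)}^{BLO}=\{f\in BLO(J):\ \inf_{g\in L^\infty(J)}\|f-g\|_{BLO(J)}=0\}.$$ Let $A_1(J)$ be the class of locally integrable, almost everywhere positive $w$ on $J$ with $\sup_{I}\frac{\frac1{|I|}\int_I w\,dx}{\inf_I w}<\infty$, with $I$ as above. Then, both for $J=\mathbb R$ and for $J=(0,1/e)$, $$L^\infty(J)\subsetneq T(J)\subsetneq\overline{L^\infty(J)}^{BLO}.$$ Moreover, on $J=(0,1/e)$: (i) the function $f(x)=\log(-\log x)$ does not belong to $L^\infty(J)$,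 but it belongs to $T(J)$; also $e^{f/\mu}\in A_1(J)$ for every $\mu>0$; (ii) the step function $\eta=\sum_{n=0}^\infty n\,\chi_{[a_{n+1},a_n)}$ with $a_n=e^{-e^n}$ belongs to $\overline{L^\infty(J)}^{BLO}$, but not to $T(J)$; also $e^{\eta/\mu}\in A_1(J)$ for every $\mu>0$. -/

import Mathlib

open MeasureTheory Set Filter Topology
open scoped ENNReal

noncomputable section

namespace LowerOscillation

/-- The lower oscillation `f_I - inf_I f` of `f` on `I = [a, b]`, where `f_I` is the mean of `f`
over `I` and `inf_I` is the essential infimum. The essential infimum is taken in `EReal`, so that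
it is `-∞` (and the oscillation is `∞`) when `f` is not essentially bounded below on `I`. -/
def lowerOsc (f : ℝ → ℝ) (a b : ℝ) : ℝ≥0∞ :=
  (((⨍ x in Icc a b, f x : ℝ) : EReal)
    - essInf (fun x => (f x : EReal)) (volume.restrict (Icc a b))).toENNReal

/-- `‖f‖_{BLO(J)}`: the supremum of the lower oscillations of `f` over all nondegenerate compact
intervals contained in `J`. -/
def bloNorm (J : Set ℝ) (f : ℝ → ℝ) : ℝ≥0∞ :=
  ⨆ (a : ℝ) (b : ℝ) (_ : a < b) (_ : Icc a b ⊆ J), lowerOsc f a b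

/-- The class `BLO(J)` of functions of bounded lower oscillation on `J`. -/
def BLO (J : Set ℝ) : Set (ℝ → ℝ) :=
  {f | LocallyIntegrableOn f J volume ∧ bloNorm J f < ∞}

/-- The class `L^∞(J)` of essentially bounded measurable functions on `J`. -/
def Linfty (J : Set ℝ) : Set (ℝ → ℝ) :=
  {f | MemLp f ∞ (volume.restrict J)}

/-- The truncation `T_k f` of `f` at the levels `-k` and `k`. -/
def trunc (k : ℕ) (f : ℝ → ℝ) : ℝ → ℝ :=
  fun x => max (-(k : ℝ)) (min (k : ℝ) (f x))

/-- The class `T` of the functions of `BLO(J)` that are approximated by their truncations. -/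
def TruncApprox (J : Set ℝ) : Set (ℝ → ℝ) :=
  {f | f ∈ BLO J ∧ Tendsto (fun k : ℕ => bloNorm J (f - trunc k f)) atTop (𝓝 0)}

/-- The distance `inf {‖f - g‖_{BLO(J)} : g ∈ L^∞(J)}` of `f` from `L^∞(J)`. -/
def distLinfty (J : Set ℝ) (f : ℝ → ℝ) : ℝ≥0∞ :=
  ⨅ g ∈ Linfty J, bloNorm J (f - g)

/-- The closure of `L^∞(J)` in `BLO(J)`. -/
def closureLinfty (J : Set ℝ) : Set (ℝ → ℝ) :=
  {f | f ∈ BLO J ∧ distLinfty J f = 0}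

/-- The `A_1` constant of `w` on `J`: the supremum of `w_I / inf_I w` over all nondegenerate
compact intervals `I` contained in `J`. -/
def A1Const (J : Set ℝ) (w : ℝ → ℝ) : ℝ≥0∞ :=
  ⨆ (a : ℝ) (b : ℝ) (_ : a < b) (_ : Icc a b ⊆ J),
    ENNReal.ofReal (⨍ x in Icc a b, w x) /
      essInf (fun x => ENNReal.ofReal (w x)) (volume.restrict (Icc a b))

/-- The Muckenhoupt class `A_1(J)`: locally integrable, almost everywhere positive weights with
finite `A_1` constant. -/
def MuckenhouptA1 (J : Set ℝ) : Set (ℝ → ℝ) :=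
  {w | LocallyIntegrableOn w J volume ∧ (∀ᵐ x ∂(volume.restrict J), 0 < w x) ∧ A1Const J w < ∞}

/-- The interval `(0, 1/e)`. -/
def baseInterval : Set ℝ := Ioo 0 (1 / Real.exp 1)

/-- The function `x ↦ log (-log x)`. -/
def logLog (x : ℝ) : ℝ := Real.log (-Real.log x)

/-- The sequence `a_n = e^{-e^n}`. -/
def stepPoint (n : ℕ) : ℝ := Real.exp (-Real.exp (n : ℝ))

/-- The step function `∑ n χ_{[a_{n+1}, a_n)}`; at each point at most one term is nonzero. -/
def stepFun (x : ℝ) : ℝ :=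
  ∑' n : ℕ, (n : ℝ) * (Ico (stepPoint (n + 1)) (stepPoint n)).indicator (fun _ => (1 : ℝ)) x

end LowerOscillation

end

/-!
Both examples are compared with `L x = log⁺ (-log |x|)`, which makes sense on the whole line. On an
interval, put `r = max |x|`. For `|x| ≤ r` the function `L` satisfies
`0 ≤ L x - L r ≤ log (1 + log (r / |x|))`, and the right-hand side, as well as any positive power of
`1 + log (r / |x|)`, is dominated by the `A_1` weight `(r / |x|) ^ (1 / 2)`, whose mean over the
interval is at most an absolute constant. Hence every function within bounded distance of `L` is in
`BLO`, and its exponentials are in `A_1`. For `L - T_k L` the bound improves to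
`log (1 + e ^ (-k) * log (r / |x|))`, so that `‖L - T_k L‖ = O(e ^ (-k))`.

The step function is a bounded perturbation of `L`, so it lies in the closure of `L^∞`. Subtracting
a truncation leaves its later unit jumps in place, and each of them costs `1 / 2` in the norm, as
one sees on short intervals centred at the jump.
-/

namespace LowerOscillation

/-! ### Averages and oscillations on a single interval -/

lemma neZero_volume_restrict_Icc {a b : ℝ} (hab : a < b) : NeZero (volume.restrict (Icc a b)) :=
  ⟨by simpa [Measure.restrict_eq_zero] using hab⟩

lemma average_le_add_mul_average {X : Type*} [MeasurableSpace X] {μ : Measure X}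
    [IsFiniteMeasure μ] [NeZero μ] {f g : X → ℝ} (hf : Integrable f μ) (hg : Integrable g μ)
    {A B : ℝ} (h : ∀ᵐ x ∂μ, f x ≤ A + B * g x) : ⨍ x, f x ∂μ ≤ A + B * ⨍ x, g x ∂μ := by
  have hBg : Integrable (fun x => B * g x) ((μ univ)⁻¹ • μ) := (hg.const_mul B).to_average
  calc ⨍ x, f x ∂μ
      ≤ ⨍ x, (A + B * g x) ∂μ :=
        integral_mono_ae hf.to_average ((integrable_const A).add hBg) (Measure.ae_smul_measure h _)
    _ = ⨍ _, A ∂μ + B * ⨍ x, g x ∂μ := by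
        rw [average, integral_add (integrable_const A) hBg, integral_const_mul]; rfl
    _ = A + B * ⨍ x, g x ∂μ := by rw [average_const]

lemma lowerOsc_le {f : ℝ → ℝ} {a b m M : ℝ}
    (hm : ∀ᵐ x ∂(volume.restrict (Icc a b)), m ≤ f x) (hM : ⨍ x in Icc a b, f x ≤ M) :
    lowerOsc f a b ≤ ENNReal.ofReal (M - m) := by
  have hinf : (m : EReal) ≤ essInf (fun x => (f x : EReal)) (volume.restrict (Icc a b)) :=
    le_essInf_of_ae_le _ (hm.mono fun _ hx => EReal.coe_le_coe_iff.2 hx)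
  rw [← EReal.real_coe_toENNReal, EReal.coe_sub]
  exact EReal.toENNReal_le_toENNReal (EReal.sub_le_sub (EReal.coe_le_coe_iff.2 hM) hinf)

lemma le_lowerOsc {f : ℝ → ℝ} {a b m M : ℝ}
    (hm : ∃ᶠ x in ae (volume.restrict (Icc a b)), f x ≤ m) (hM : M ≤ ⨍ x in Icc a b, f x) :
    ENNReal.ofReal (M - m) ≤ lowerOsc f a b := by
  have hinf : essInf (fun x => (f x : EReal)) (volume.restrict (Icc a b)) ≤ (m : EReal) :=
    liminf_le_of_frequently_le' (hm.mono fun _ hx => EReal.coe_le_coe_iff.2 hx)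
  rw [← EReal.real_coe_toENNReal, EReal.coe_sub]
  exact EReal.toENNReal_le_toENNReal (EReal.sub_le_sub (EReal.coe_le_coe_iff.2 hM) hinf)

lemma lowerOsc_congr {f g : ℝ → ℝ} {a b : ℝ} (h : f =ᵐ[volume.restrict (Icc a b)] g) :
    lowerOsc f a b = lowerOsc g a b := by
  have hE : (fun x => (f x : EReal)) =ᵐ[volume.restrict (Icc a b)] fun x => (g x : EReal) :=
    h.fun_comp Real.toEReal
  rw [lowerOsc, lowerOsc, average_congr h, essInf_congr_ae hE]

section Jump

variable {f : ℝ → ℝ} {s d u v : ℝ}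

lemma setAverage_of_jump (hd : 0 < d) (hleft : EqOn f (fun _ => u) (Ico (s - d) s))
    (hright : EqOn f (fun _ => v) (Icc s (s + d))) :
    ⨍ x in Icc (s - d) (s + d), f x = (u + v) / 2 := by
  have hdisj : Disjoint (Ico (s - d) s) (Icc s (s + d)) :=
    disjoint_left.2 fun _ hx hx' => hx.2.not_ge hx'.1
  rw [setAverage_eq, ← Ico_union_Icc_eq_Icc (sub_lt_self s hd).le (lt_add_of_pos_right s hd).le,
    setIntegral_union hdisj measurableSet_Icc
      ((integrableOn_const (by simp)).congr_fun hleft.symm measurableSet_Ico)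
      ((integrableOn_const (by simp)).congr_fun hright.symm measurableSet_Icc),
    setIntegral_congr_fun measurableSet_Ico hleft, setIntegral_congr_fun measurableSet_Icc hright,
    Ico_union_Icc_eq_Icc (sub_lt_self s hd).le (lt_add_of_pos_right s hd).le]
  simp only [setIntegral_const, smul_eq_mul]
  rw [Real.volume_real_Icc_of_le (by linarith), Real.volume_real_Icc_of_le (by linarith),
    Real.volume_real_Ico_of_le (by linarith)]
  rw [sub_sub_cancel, add_sub_cancel_left, show s + d - (s - d) = 2 * d by ring]
  have hd0 := hd.ne'
  field_simp

lemma half_jump_le_lowerOsc (hd : 0 < d) (hleft : EqOn f (fun _ => u) (Ico (s - d) s))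
    (hright : EqOn f (fun _ => v) (Icc s (s + d))) :
    ENNReal.ofReal ((u - v) / 2) ≤ lowerOsc f (s - d) (s + d) := by
  have hfreq : ∃ᶠ x in ae (volume.restrict (Icc (s - d) (s + d))), f x ≤ v := by
    have : NeZero (volume.restrict (Icc s (s + d))) :=
      neZero_volume_restrict_Icc (lt_add_of_pos_right s hd)
    have hev : ∀ᵐ x ∂(volume.restrict (Icc s (s + d))), f x ≤ v :=
      (ae_restrict_mem measurableSet_Icc).mono fun x hx => (hright hx).le
    exact hev.frequently.filter_mono
      (ae_mono (Measure.restrict_mono (Icc_subset_Icc_left (sub_lt_self s hd).le) le_rfl))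
  have hosc := le_lowerOsc hfreq (setAverage_of_jump hd hleft hright).ge
  rwa [show (u + v) / 2 - v = (u - v) / 2 by ring] at hosc

end Jump

/-! ### Changing the interval -/

section Restriction

variable {J K : Set ℝ} {f g : ℝ → ℝ}

lemma bloNorm_le_iff {C : ℝ≥0∞} :
    bloNorm J f ≤ C ↔ ∀ a b, a < b → Icc a b ⊆ J → lowerOsc f a b ≤ C := by
  simp only [bloNorm, iSup_le_iff]

lemma lowerOsc_le_bloNorm (f : ℝ → ℝ) {a b : ℝ} (hab : a < b) (h : Icc a b ⊆ J) :
    lowerOsc f a b ≤ bloNorm J f :=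
  bloNorm_le_iff.1 le_rfl a b hab h

lemma bloNorm_le_of_ae_eq (hJK : J ⊆ K) (h : f =ᵐ[volume.restrict J] g) :
    bloNorm J f ≤ bloNorm K g :=
  bloNorm_le_iff.2 fun _ _ hab hJ =>
    (lowerOsc_congr (ae_restrict_of_ae_restrict_of_subset hJ h)).trans_le
      (lowerOsc_le_bloNorm g hab (hJ.trans hJK))

lemma mem_Linfty_of_ae_eq (hJK : J ⊆ K) (h : f =ᵐ[volume.restrict J] g) (hg : g ∈ Linfty K) :
    f ∈ Linfty J :=
  (memLp_congr_ae h).2 (MemLp.mono_measure (Measure.restrict_mono hJK le_rfl) hg)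

lemma mem_BLO_of_ae_eq (hJK : J ⊆ K) (h : f =ᵐ[volume.restrict J] g) (hg : g ∈ BLO K) :
    f ∈ BLO J :=
  ⟨(locallyIntegrableOn_congr h).2 (hg.1.mono_set hJK), (bloNorm_le_of_ae_eq hJK h).trans_lt hg.2⟩

lemma mem_TruncApprox_of_ae_eq (hJK : J ⊆ K) (h : f =ᵐ[volume.restrict J] g)
    (hg : g ∈ TruncApprox K) : f ∈ TruncApprox J := by
  refine ⟨mem_BLO_of_ae_eq hJK h hg.1, tendsto_of_tendsto_of_tendsto_of_le_of_le
    tendsto_const_nhds hg.2 (fun _ => zero_le) fun k => bloNorm_le_of_ae_eq hJK ?_⟩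
  exact h.fun_comp fun y => y - max (-(k : ℝ)) (min (k : ℝ) y)

lemma mem_closureLinfty_of_ae_eq (hJK : J ⊆ K) (h : f =ᵐ[volume.restrict J] g)
    (hg : g ∈ closureLinfty K) : f ∈ closureLinfty J := by
  refine ⟨mem_BLO_of_ae_eq hJK h hg.1, le_antisymm ?_ zero_le⟩
  rw [← hg.2]
  exact le_iInf₂ fun u hu => iInf₂_le_of_le u (mem_Linfty_of_ae_eq hJK (ae_eq_refl u) hu)
    (bloNorm_le_of_ae_eq hJK (h.sub (ae_eq_refl u)))

lemma A1Const_le_of_ae_eq (hJK : J ⊆ K) (h : f =ᵐ[volume.restrict J] g) :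
    A1Const J f ≤ A1Const K g := by
  refine iSup₂_le fun a b => iSup₂_le fun hab hJ =>
    le_iSup₂_of_le a b (le_iSup₂_of_le hab (hJ.trans hJK) (le_of_eq ?_))
  have hI : f =ᵐ[volume.restrict (Icc a b)] g := ae_restrict_of_ae_restrict_of_subset hJ h
  have hofReal : (fun x => ENNReal.ofReal (f x)) =ᵐ[volume.restrict (Icc a b)]
      fun x => ENNReal.ofReal (g x) := hI.fun_comp ENNReal.ofReal
  rw [average_congr hI, essInf_congr_ae hofReal]

lemma mem_MuckenhouptA1_of_ae_eq (hJK : J ⊆ K) (h : f =ᵐ[volume.restrict J] g)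
    (hg : g ∈ MuckenhouptA1 K) : f ∈ MuckenhouptA1 J := by
  refine ⟨(locallyIntegrableOn_congr h).2 (hg.1.mono_set hJK), ?_,
    (A1Const_le_of_ae_eq hJK h).trans_lt hg.2.2⟩
  filter_upwards [ae_restrict_of_ae_restrict_of_subset hJK hg.2.1, h] with x hpos hx
  rwa [hx]

end Restriction

/-! ### The inclusions `L^∞ ⊆ T ⊆ closure of L^∞` -/

section Inclusions

variable {J : Set ℝ} {f g : ℝ → ℝ}

lemma abs_trunc_le (k : ℕ) (f : ℝ → ℝ) (x : ℝ) : |trunc k f x| ≤ k :=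
  abs_le.2 ⟨le_max_left _ _, max_le (neg_le_self k.cast_nonneg) (min_le_left _ _)⟩

lemma trunc_apply_of_abs_le {k : ℕ} {x : ℝ} (h : |f x| ≤ k) : trunc k f x = f x := by
  rw [trunc, min_eq_right (abs_le.1 h).2, max_eq_right (abs_le.1 h).1]

lemma sub_trunc_apply_of_nonneg (k : ℕ) {x : ℝ} (h : 0 ≤ f x) :
    (f - trunc k f) x = max 0 (f x - k) := by
  have hlevel : -(k : ℝ) ≤ min (k : ℝ) (f x) :=
    (neg_nonpos.2 k.cast_nonneg).trans (le_min k.cast_nonneg h)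
  rw [Pi.sub_apply, trunc, max_eq_right hlevel]
  rcases le_total (k : ℝ) (f x) with hkf | hkf
  · rw [min_eq_left hkf, max_eq_right (sub_nonneg.2 hkf)]
  · rw [min_eq_right hkf, sub_self, max_eq_left (sub_nonpos.2 hkf)]

lemma aestronglyMeasurable_trunc {μ : Measure ℝ} (k : ℕ) (hf : AEStronglyMeasurable f μ) :
    AEStronglyMeasurable (trunc k f) μ :=
  (show Continuous fun y : ℝ => max (-(k : ℝ)) (min (k : ℝ) y) by
    fun_prop).comp_aestronglyMeasurable hf

lemma trunc_mem_Linfty (k : ℕ) (hf : AEStronglyMeasurable f (volume.restrict J)) :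
    trunc k f ∈ Linfty J :=
  memLp_top_of_bound (aestronglyMeasurable_trunc k hf) k (ae_of_all _ (abs_trunc_le k f))

lemma exists_ae_abs_le_of_mem_Linfty (hf : f ∈ Linfty J) :
    ∃ C : ℝ, ∀ᵐ x ∂(volume.restrict J), |f x| ≤ C := by
  have hsup : eLpNormEssSup f (volume.restrict J) < ∞ := by
    simpa only [eLpNorm_exponent_top] using (hf : MemLp f ∞ (volume.restrict J)).2
  obtain ⟨C, hC⟩ := eLpNormEssSup_lt_top_iff_isBoundedUnder.1 hsup
  exact ⟨C, (eventually_map.1 hC).mono fun _ hx => NNReal.coe_le_coe.2 hx⟩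

lemma locallyIntegrableOn_of_mem_Linfty (hf : f ∈ Linfty J) : LocallyIntegrableOn f J :=
  locallyIntegrableOn_of_locallyIntegrable_restrict (MemLp.locallyIntegrable hf le_top)

lemma bloNorm_le_of_ae_mem_Icc {m M : ℝ} (hf : LocallyIntegrableOn f J)
    (h : ∀ᵐ x ∂(volume.restrict J), f x ∈ Icc m M) : bloNorm J f ≤ ENNReal.ofReal (M - m) := by
  refine bloNorm_le_iff.2 fun a b hab hJ => ?_
  have : NeZero (volume.restrict (Icc a b)) := neZero_volume_restrict_Icc hab
  have hI := ae_restrict_of_ae_restrict_of_subset hJ h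
  have hint := hf.integrableOn_compact_subset hJ isCompact_Icc
  exact lowerOsc_le (hI.mono fun x hx => hx.1)
    ((convex_Icc m M).average_mem isClosed_Icc hI hint).2

lemma Linfty_subset_BLO (J : Set ℝ) : Linfty J ⊆ BLO J := fun f hf => by
  obtain ⟨C, hC⟩ := exists_ae_abs_le_of_mem_Linfty hf
  have hint := locallyIntegrableOn_of_mem_Linfty hf
  exact ⟨hint, (bloNorm_le_of_ae_mem_Icc hint (hC.mono fun x hx => abs_le.1 hx)).trans_lt
    ENNReal.ofReal_lt_top⟩

lemma bloNorm_eq_zero_of_ae_eq_zero (h : f =ᵐ[volume.restrict J] 0) : bloNorm J f = 0 := by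
  have hint : LocallyIntegrableOn f J :=
    (locallyIntegrableOn_congr h).2 (locallyIntegrable_zero.locallyIntegrableOn J)
  simpa using bloNorm_le_of_ae_mem_Icc (m := 0) (M := 0) hint (h.mono fun x hx => by simp [hx])

lemma Linfty_subset_TruncApprox (J : Set ℝ) : Linfty J ⊆ TruncApprox J := fun f hf => by
  obtain ⟨C, hC⟩ := exists_ae_abs_le_of_mem_Linfty hf
  obtain ⟨N, hN⟩ := exists_nat_ge C
  refine ⟨Linfty_subset_BLO J hf, tendsto_const_nhds.congr' ?_⟩
  filter_upwards [eventually_ge_atTop N] with k hk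
  refine (bloNorm_eq_zero_of_ae_eq_zero (hC.mono fun x hx => ?_)).symm
  have hxk : |f x| ≤ k := hx.trans (hN.trans (Nat.cast_le.2 hk))
  rw [Pi.sub_apply, trunc_apply_of_abs_le hxk, sub_self, Pi.zero_apply]

lemma TruncApprox_subset_closureLinfty (J : Set ℝ) : TruncApprox J ⊆ closureLinfty J :=
  fun f hf => ⟨hf.1, le_antisymm (ge_of_tendsto' hf.2 fun k =>
    iInf₂_le (trunc k f) (trunc_mem_Linfty k hf.1.1.aestronglyMeasurable)) zero_le⟩

lemma mem_closureLinfty_of_sub_mem_Linfty (hf : f ∈ closureLinfty J) (hg : g ∈ BLO J)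
    (hgf : g - f ∈ Linfty J) : g ∈ closureLinfty J := by
  refine ⟨hg, le_antisymm ?_ zero_le⟩
  rw [← hf.2]
  refine le_iInf₂ fun u hu => iInf₂_le_of_le (u + (g - f)) (MemLp.add hu hgf) (le_of_eq ?_)
  congr 1
  abel

end Inclusions

/-! ### Domination by the power weights `|x|^{-α}` -/

section PowerWeight

variable {p α : ℝ}

lemma intervalIntegrable_abs_rpow (hp : -1 < p) (a b : ℝ) :
    IntervalIntegrable (fun x => |x| ^ p) volume a b :=
  intervalIntegrable_of_even (fun x => by rw [abs_neg])
    (fun r hr => (intervalIntegral.intervalIntegrable_rpow' hp).congr fun x hx => by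
      rw [uIoc_of_le hr.le] at hx
      simp only [abs_of_pos hx.1])

lemma integral_abs_rpow (hp : -1 < p) (a b : ℝ) :
    ∫ x in a..b, |x| ^ p = (b * |b| ^ p - a * |a| ^ p) / (p + 1) := by
  have hzero_pos : ∀ c, 0 ≤ c → ∫ x in 0..c, |x| ^ p = c * |c| ^ p / (p + 1) := fun c hc => by
    have hcongr : EqOn (fun x : ℝ => |x| ^ p) (fun x => x ^ p) (uIcc 0 c) := fun x hx => by
      rw [uIcc_of_le hc] at hx
      simp only [abs_of_nonneg hx.1]
    rw [intervalIntegral.integral_congr hcongr, integral_rpow (Or.inl hp),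
      Real.zero_rpow (by linarith), sub_zero, Real.rpow_add_one' hc (by linarith),
      abs_of_nonneg hc, mul_comm]
  have hzero : ∀ c, ∫ x in 0..c, |x| ^ p = c * |c| ^ p / (p + 1) := fun c => by
    rcases le_total 0 c with hc | hc
    · exact hzero_pos c hc
    · have hneg : ∫ x in -0..-(-c), |x| ^ p = -∫ x in 0..-c, |x| ^ p := by
        rw [intervalIntegral.integral_symm, ← intervalIntegral.integral_comp_neg]
        simp only [abs_neg]
      rw [neg_zero, neg_neg, hzero_pos (-c) (neg_nonneg.2 hc), abs_neg] at hneg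
      rw [hneg]
      ring
  have hsplit := intervalIntegral.integral_interval_sub_left
    (intervalIntegrable_abs_rpow hp 0 b) (intervalIntegrable_abs_rpow hp 0 a)
  rw [← hsplit, hzero, hzero, sub_div]

lemma mul_abs_rpow_sub_le_of_abs_le {a b : ℝ} (hα₀ : 0 ≤ α) (hα₁ : α < 1) (hab : a < b)
    (h : |a| ≤ |b|) : b * |b| ^ (-α) - a * |a| ^ (-α) ≤ 2 * (b - a) * |b| ^ (-α) := by
  have hb : 0 < b := by
    by_contra! hb
    rw [abs_of_nonpos hb, abs_of_neg (hab.trans_le hb)] at h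
    linarith
  have hbα : 0 ≤ b ^ (-α) := Real.rpow_nonneg hb.le _
  rw [abs_of_pos hb] at h ⊢
  rcases le_or_gt 0 a with ha | ha
  · rw [abs_of_nonneg ha]
    have hmono : a * b ^ (-α) ≤ a * a ^ (-α) := by
      rcases ha.eq_or_lt with rfl | ha
      · simp only [zero_mul, le_refl]
      · exact mul_le_mul_of_nonneg_left
          (Real.rpow_le_rpow_of_nonpos ha hab.le (neg_nonpos.2 hα₀)) ha.le
    nlinarith
  · have hmono : |a| ^ (-α) * |a| ≤ b ^ (-α) * b := by
      rw [← Real.rpow_add_one' (abs_nonneg a) (by linarith),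
        ← Real.rpow_add_one' hb.le (by linarith)]
      exact Real.rpow_le_rpow (abs_nonneg a) h (by linarith)
    rw [abs_of_neg ha] at hmono ⊢
    nlinarith

lemma mul_abs_rpow_sub_le {a b : ℝ} (hα₀ : 0 ≤ α) (hα₁ : α < 1) (hab : a < b) :
    b * |b| ^ (-α) - a * |a| ^ (-α) ≤ 2 * (b - a) * max |a| |b| ^ (-α) := by
  rcases le_total |a| |b| with h | h
  · rw [max_eq_right h]
    exact mul_abs_rpow_sub_le_of_abs_le hα₀ hα₁ hab h
  · have hreflect := mul_abs_rpow_sub_le_of_abs_le hα₀ hα₁ (neg_lt_neg hab)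
      (by rwa [abs_neg, abs_neg])
    rw [abs_neg, abs_neg] at hreflect
    rw [max_eq_left h]
    linarith

lemma div_abs_rpow {r : ℝ} (hr : 0 ≤ r) (x : ℝ) :
    (r / |x|) ^ α = r ^ α * |x| ^ (-α) := by
  rw [Real.div_rpow hr (abs_nonneg x), Real.rpow_neg (abs_nonneg x), div_eq_mul_inv]

lemma integrableOn_div_abs_rpow (hα : α < 1) {r a b : ℝ} (hr : 0 ≤ r) (hab : a ≤ b) :
    IntegrableOn (fun x => (r / |x|) ^ α) (Icc a b) := by
  simp only [div_abs_rpow hr]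
  exact ((intervalIntegrable_iff_integrableOn_Icc_of_le hab).1
    (intervalIntegrable_abs_rpow (by linarith) a b)).const_mul _

lemma setAverage_div_abs_rpow_le (hα₀ : 0 ≤ α) (hα₁ : α < 1) {a b : ℝ} (hab : a < b) :
    ⨍ x in Icc a b, (max |a| |b| / |x|) ^ α ≤ 2 / (1 - α) := by
  have hr : 0 ≤ max |a| |b| := le_max_of_le_left (abs_nonneg a)
  have hpow : max |a| |b| ^ α * max |a| |b| ^ (-α) ≤ 1 := by
    rw [Real.rpow_neg hr]
    exact mul_inv_le_one
  have hden : 0 < (b - a) * (1 - α) := mul_pos (sub_pos.2 hab) (sub_pos.2 hα₁)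
  simp only [div_abs_rpow hr]
  rw [setAverage_eq, integral_const_mul, integral_Icc_eq_integral_Ioc,
    ← intervalIntegral.integral_of_le hab.le, integral_abs_rpow (by linarith),
    Real.volume_real_Icc_of_le hab.le, smul_eq_mul, neg_add_eq_sub]
  calc (b - a)⁻¹ * (max |a| |b| ^ α * ((b * |b| ^ (-α) - a * |a| ^ (-α)) / (1 - α)))
      = max |a| |b| ^ α * (b * |b| ^ (-α) - a * |a| ^ (-α)) / ((b - a) * (1 - α)) := by
        field_simp
    _ ≤ max |a| |b| ^ α * (2 * (b - a) * max |a| |b| ^ (-α)) / ((b - a) * (1 - α)) := by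
        exact div_le_div_of_nonneg_right
          (mul_le_mul_of_nonneg_left (mul_abs_rpow_sub_le hα₀ hα₁ hab) (by positivity)) hden.le
    _ = max |a| |b| ^ α * max |a| |b| ^ (-α) * (2 * (b - a)) / ((b - a) * (1 - α)) := by ring
    _ ≤ 1 * (2 * (b - a)) / ((b - a) * (1 - α)) := by
        gcongr
    _ = 2 / (1 - α) := by
        have := (sub_pos.2 hab).ne'
        field_simp

lemma ae_restrict_Icc_of_forall_abs_le {P : ℝ → Prop} {a b : ℝ}
    (h : ∀ x, x ≠ 0 → |x| ≤ max |a| |b| → P x) : ∀ᵐ x ∂(volume.restrict (Icc a b)), P x := by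
  filter_upwards [ae_restrict_of_ae (Measure.ae_ne volume 0), ae_restrict_mem measurableSet_Icc]
    with x hx hI
  exact h x hx (abs_le_max_abs_abs hI.1 hI.2)

lemma locallyIntegrable_of_abs_le_rpow (hα : α < 1) {f A B : ℝ → ℝ}
    (hf : AEStronglyMeasurable f)
    (h : ∀ r x, x ≠ 0 → |x| ≤ r → |f x| ≤ A r + B r * (r / |x|) ^ α) : LocallyIntegrable f := by
  have hIcc : ∀ r, 0 ≤ r → IntegrableOn f (Icc (-r) r) := fun r hr => by
    refine (integrableOn_const (by simp)).add
      ((integrableOn_div_abs_rpow hα hr (neg_le_self hr)).const_mul (B r)) |>.mono'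
      hf.restrict (ae_restrict_Icc_of_forall_abs_le fun x hx hxr => h r x hx ?_)
    rwa [abs_neg, max_self, abs_of_nonneg hr] at hxr
  exact fun x => ⟨Icc (-(|x| + 1)) (|x| + 1),
    Icc_mem_nhds (by linarith [neg_abs_le x]) (by linarith [le_abs_self x]), hIcc _ (by positivity)⟩

lemma setAverage_le_of_le_rpow (hα₀ : 0 ≤ α) (hα₁ : α < 1) {f : ℝ → ℝ} {a b A B : ℝ}
    (hab : a < b) (hB : 0 ≤ B) (hf : IntegrableOn f (Icc a b))
    (h : ∀ x, x ≠ 0 → |x| ≤ max |a| |b| → f x ≤ A + B * (max |a| |b| / |x|) ^ α) :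
    ⨍ x in Icc a b, f x ≤ A + B * (2 / (1 - α)) := by
  have : NeZero (volume.restrict (Icc a b)) := neZero_volume_restrict_Icc hab
  calc ⨍ x in Icc a b, f x
      ≤ A + B * ⨍ x in Icc a b, (max |a| |b| / |x|) ^ α :=
        average_le_add_mul_average hf
          (integrableOn_div_abs_rpow hα₁ (le_max_of_le_left (abs_nonneg a)) hab.le)
          (ae_restrict_Icc_of_forall_abs_le h)
    _ ≤ A + B * (2 / (1 - α)) := by
        gcongr
        exact setAverage_div_abs_rpow_le hα₀ hα₁ hab

section RadialBounds

variable {f h : ℝ → ℝ} {B C c : ℝ}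

lemma locallyIntegrable_of_radial_bounds (hα : α < 1) (hf : AEStronglyMeasurable f)
    (hlow : ∀ r x, x ≠ 0 → |x| ≤ r → h r ≤ f x)
    (hup : ∀ r x, x ≠ 0 → |x| ≤ r → f x ≤ h r + c + B * (r / |x|) ^ α) : LocallyIntegrable f := by
  refine locallyIntegrable_of_abs_le_rpow (A := fun r => |h r| + c) (B := fun _ => B) hα hf
    fun r x hx hr => ?_
  have hl := hlow r x hx hr
  have hu := hup r x hx hr
  exact abs_le.2 ⟨by linarith [neg_abs_le (h r)], by linarith [le_abs_self (h r)]⟩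

lemma bloNorm_le_of_radial_bounds (hα₀ : 0 ≤ α) (hα₁ : α < 1) (hB : 0 ≤ B)
    (hf : AEStronglyMeasurable f) (hlow : ∀ r x, x ≠ 0 → |x| ≤ r → h r ≤ f x)
    (hup : ∀ r x, x ≠ 0 → |x| ≤ r → f x ≤ h r + c + B * (r / |x|) ^ α) :
    bloNorm univ f ≤ ENNReal.ofReal (c + B * (2 / (1 - α))) := by
  refine bloNorm_le_iff.2 fun a b hab _ => ?_
  have hint := (locallyIntegrable_of_radial_bounds hα₁ hf hlow hup).integrableOn_isCompact
    (isCompact_Icc (a := a) (b := b))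
  refine (lowerOsc_le (ae_restrict_Icc_of_forall_abs_le (hlow _))
    (setAverage_le_of_le_rpow hα₀ hα₁ hab hB hint (hup _))).trans_eq ?_
  rw [add_assoc, add_sub_cancel_left]

lemma mem_MuckenhouptA1_of_radial_bounds (hα₀ : 0 ≤ α) (hα₁ : α < 1) (hC : 0 ≤ C)
    (hf : AEStronglyMeasurable f) (hpos : ∀ r, 0 < h r)
    (hlow : ∀ r x, x ≠ 0 → |x| ≤ r → h r ≤ f x)
    (hup : ∀ r x, x ≠ 0 → |x| ≤ r → f x ≤ C * h r * (r / |x|) ^ α) :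
    f ∈ MuckenhouptA1 univ := by
  have hfpos : ∀ x, x ≠ 0 → 0 < f x := fun x hx => (hpos _).trans_le (hlow _ x hx le_rfl)
  have hint : LocallyIntegrable f :=
    locallyIntegrable_of_abs_le_rpow (A := 0) (B := fun r => C * h r) hα₁ hf fun r x hx hr => by
      rw [abs_of_pos (hfpos x hx), Pi.zero_apply, zero_add]
      exact hup r x hx hr
  refine ⟨hint.locallyIntegrableOn _,
    ae_restrict_of_ae ((Measure.ae_ne volume 0).mono hfpos), ?_⟩
  suffices hA1 : A1Const univ f ≤ ENNReal.ofReal (C * (2 / (1 - α))) from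
    hA1.trans_lt ENNReal.ofReal_lt_top
  refine iSup₂_le fun a b => iSup₂_le fun hab _ => ENNReal.div_le_of_le_mul ?_
  set r := max |a| |b|
  have hmean : ⨍ x in Icc a b, f x ≤ 0 + C * h r * (2 / (1 - α)) :=
    setAverage_le_of_le_rpow hα₀ hα₁ hab (mul_nonneg hC (hpos r).le)
      (hint.integrableOn_isCompact isCompact_Icc)
      fun x hx hr => (hup r x hx hr).trans_eq (zero_add _).symm
  have hinf : ENNReal.ofReal (h r) ≤
      essInf (fun x => ENNReal.ofReal (f x)) (volume.restrict (Icc a b)) :=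
    le_essInf_of_ae_le _ (ae_restrict_Icc_of_forall_abs_le fun x hx hr =>
      ENNReal.ofReal_le_ofReal (hlow r x hx hr))
  calc ENNReal.ofReal (⨍ x in Icc a b, f x)
      ≤ ENNReal.ofReal (C * (2 / (1 - α)) * h r) :=
        ENNReal.ofReal_le_ofReal (hmean.trans_eq (by ring))
    _ = ENNReal.ofReal (C * (2 / (1 - α))) * ENNReal.ofReal (h r) :=
        ENNReal.ofReal_mul' (hpos r).le
    _ ≤ _ := by gcongr

end RadialBounds

end PowerWeight

/-! ### The even extension of `log (-log x)` and functions close to it -/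

/-- The even extension to the line of the positive part of `log (-log x)`. It is even because
`Real.log x = log |x|`. -/
noncomputable def posLogLog (x : ℝ) : ℝ := Real.log (max 1 (-Real.log x))

lemma posLogLog_nonneg (x : ℝ) : 0 ≤ posLogLog x := Real.log_nonneg (le_max_left _ _)

lemma measurable_posLogLog : Measurable posLogLog :=
  Real.measurable_log.comp (measurable_const.max Real.measurable_log.neg)

lemma logLog_eq_posLogLog {x : ℝ} (hx : x ∈ baseInterval) : logLog x = posLogLog x := by
  have hlog : Real.log x < -1 := by
    rw [Real.log_lt_iff_lt_exp hx.1, Real.exp_neg, ← one_div]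
    exact hx.2
  rw [logLog, posLogLog, max_eq_right (by linarith)]

section Radial

variable {r x : ℝ}

lemma posLogLog_le_of_abs_le (hx : x ≠ 0) (hr : |x| ≤ r) : posLogLog r ≤ posLogLog x := by
  have hlog : Real.log x ≤ Real.log r := by
    rw [← Real.log_abs x]
    exact Real.log_le_log (abs_pos.2 hx) hr
  exact Real.log_le_log (by positivity) (max_le_max le_rfl (neg_le_neg hlog))

lemma one_le_div_abs (hx : x ≠ 0) (hr : |x| ≤ r) : 1 ≤ r / |x| :=
  (one_le_div (abs_pos.2 hx)).2 hr

lemma posLogLog_le_max_add_log (k : ℝ) (hx : x ≠ 0) (hr : |x| ≤ r) :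
    posLogLog x ≤ max k (posLogLog r) + Real.log (1 + Real.log (r / |x|) / Real.exp k) := by
  have hs : 0 ≤ Real.log (r / |x|) := Real.log_nonneg (one_le_div_abs hx hr)
  have hlog : -Real.log x = -Real.log r + Real.log (r / |x|) := by
    rw [Real.log_div ((abs_pos.2 hx).trans_le hr).ne' (abs_ne_zero.2 hx), Real.log_abs]
    ring
  -- `M` dominates `1`, `-log r` and `e ^ k`, hence `-log x ≤ M + log (r / |x|)` is at most
  -- `M * (1 + log (r / |x|) / e ^ k)`.
  set M := Real.exp (max k (posLogLog r))
  have hM : max 1 (-Real.log r) ≤ M := by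
    rw [← Real.exp_log (show 0 < max 1 (-Real.log r) by positivity)]
    exact Real.exp_le_exp.2 (le_max_right _ _)
  have hkM : Real.exp k ≤ M := Real.exp_le_exp.2 (le_max_left _ _)
  have hgrow : Real.log (r / |x|) ≤ M * (Real.log (r / |x|) / Real.exp k) := by
    rw [mul_div_left_comm]
    exact le_mul_of_one_le_right hs ((one_le_div (Real.exp_pos k)).2 hkM)
  rw [← Real.log_exp (max k (posLogLog r)), ← Real.log_mul (by positivity) (by positivity)]
  refine Real.log_le_log (by positivity) (max_le ?_ ?_)
  · nlinarith [le_max_left 1 (-Real.log r)]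
  · nlinarith [le_max_right 1 (-Real.log r)]

lemma posLogLog_le_add_log (hx : x ≠ 0) (hr : |x| ≤ r) :
    posLogLog x ≤ posLogLog r + Real.log (1 + Real.log (r / |x|)) := by
  simpa only [max_eq_right (posLogLog_nonneg r), Real.exp_zero, div_one]
    using posLogLog_le_max_add_log 0 hx hr

lemma log_one_add_log_div_exp_le (k : ℝ) {t : ℝ} (ht : 1 ≤ t) :
    Real.log (1 + Real.log t / Real.exp k) ≤ 2 / Real.exp k * t ^ (1 / 2 : ℝ) := by
  have hs : 0 ≤ Real.log t / Real.exp k := div_nonneg (Real.log_nonneg ht) (Real.exp_pos k).le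
  calc Real.log (1 + Real.log t / Real.exp k)
      ≤ Real.log t / Real.exp k := by
        linarith [Real.log_le_sub_one_of_pos (show 0 < 1 + Real.log t / Real.exp k by positivity)]
    _ ≤ t ^ (1 / 2 : ℝ) / (1 / 2) / Real.exp k := by
        gcongr
        exact Real.log_le_rpow_div (by linarith) (by norm_num)
    _ = 2 / Real.exp k * t ^ (1 / 2 : ℝ) := by ring

lemma one_add_log_rpow_le {p t : ℝ} (hp : 0 < p) (ht : 1 ≤ t) :
    (1 + Real.log t) ^ p ≤ (1 + 2 * p) ^ p * t ^ (1 / 2 : ℝ) := by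
  -- `log t ≤ t ^ ε / ε` with `ε = 1 / (2 * p)`, so that the `p`-th power gives `t ^ (1 / 2)`.
  have hε : 0 < 1 / (2 * p) := by positivity
  have hlog : 0 ≤ Real.log t := Real.log_nonneg ht
  have hone : 1 ≤ t ^ (1 / (2 * p)) := Real.one_le_rpow ht hε.le
  calc (1 + Real.log t) ^ p
      ≤ ((1 + 2 * p) * t ^ (1 / (2 * p))) ^ p := by
        have hbound : Real.log t ≤ 2 * p * t ^ (1 / (2 * p)) :=
          (Real.log_le_rpow_div (by linarith) hε).trans_eq (by field_simp)
        exact Real.rpow_le_rpow (by positivity) (by linarith) hp.le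
    _ = (1 + 2 * p) ^ p * t ^ (1 / 2 : ℝ) := by
        rw [Real.mul_rpow (by positivity) (by positivity), ← Real.rpow_mul (by linarith)]
        congr 2
        field_simp

lemma exp_posLogLog_div_le {μ : ℝ} (hμ : 0 < μ) (hx : x ≠ 0) (hr : |x| ≤ r) :
    Real.exp (posLogLog x / μ) ≤
      (1 + 2 / μ) ^ (1 / μ) * Real.exp (posLogLog r / μ) * (r / |x|) ^ (1 / 2 : ℝ) := by
  have hs : 0 ≤ Real.log (r / |x|) := Real.log_nonneg (one_le_div_abs hx hr)
  calc Real.exp (posLogLog x / μ)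
      ≤ Real.exp ((posLogLog r + Real.log (1 + Real.log (r / |x|))) / μ) := by
        gcongr
        exact posLogLog_le_add_log hx hr
    _ = Real.exp (posLogLog r / μ) * (1 + Real.log (r / |x|)) ^ (1 / μ) := by
        rw [add_div, Real.exp_add, Real.rpow_def_of_pos (by positivity), mul_one_div]
    _ ≤ Real.exp (posLogLog r / μ) * ((1 + 2 * (1 / μ)) ^ (1 / μ) * (r / |x|) ^ (1 / 2 : ℝ)) := by
        gcongr
        exact one_add_log_rpow_le (one_div_pos.2 hμ) (one_le_div_abs hx hr)
    _ = _ := by rw [mul_one_div]; ring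

end Radial

lemma bloNorm_posLogLog_sub_trunc_le (k : ℕ) :
    bloNorm univ (posLogLog - trunc k posLogLog) ≤ ENNReal.ofReal (8 / Real.exp k) := by
  have hsub : ∀ x, (posLogLog - trunc k posLogLog) x = max 0 (posLogLog x - k) := fun x =>
    sub_trunc_apply_of_nonneg k (posLogLog_nonneg x)
  have hmeas : AEStronglyMeasurable (posLogLog - trunc k posLogLog) :=
    measurable_posLogLog.aestronglyMeasurable.sub
      (aestronglyMeasurable_trunc k measurable_posLogLog.aestronglyMeasurable)
  refine (bloNorm_le_of_radial_bounds (α := 1 / 2) (B := 2 / Real.exp k) (c := 0)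
    (h := fun r => max 0 (posLogLog r - k)) (by norm_num) (by norm_num) (by positivity) hmeas
    (fun r x hx hr => ?_) fun r x hx hr => ?_).trans_eq ?_
  · rw [hsub]
    exact max_le_max le_rfl (sub_le_sub_right (posLogLog_le_of_abs_le hx hr) _)
  · have hmax : max 0 (posLogLog r - k) = max (k : ℝ) (posLogLog r) - k := by
      rw [← max_sub_sub_right, sub_self]
    have hB : 0 ≤ 2 / Real.exp k * (r / |x|) ^ (1 / 2 : ℝ) := by
      have := one_le_div_abs hx hr
      positivity
    rw [hsub, add_zero]
    refine max_le (by positivity) ?_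
    rw [hmax]
    linarith [posLogLog_le_max_add_log k hx hr,
      log_one_add_log_div_exp_le k (one_le_div_abs hx hr)]
  · congr 1
    ring

section NearPosLogLog

variable {g : ℝ → ℝ} {c : ℝ}

lemma mem_BLO_of_near_posLogLog (hg : Measurable g) (hlow : ∀ x, posLogLog x - c ≤ g x)
    (hup : ∀ x, g x ≤ posLogLog x) : g ∈ BLO univ := by
  have hrad_low : ∀ r x, x ≠ 0 → |x| ≤ r → posLogLog r - c ≤ g x := fun r x hx hr => by
    linarith [hlow x, posLogLog_le_of_abs_le hx hr]
  have hrad_up : ∀ r x, x ≠ 0 → |x| ≤ r →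
      g x ≤ posLogLog r - c + c + 2 * (r / |x|) ^ (1 / 2 : ℝ) := fun r x hx hr => by
    have hlog := log_one_add_log_div_exp_le 0 (one_le_div_abs hx hr)
    rw [Real.exp_zero, div_one, div_one] at hlog
    linarith [hup x, posLogLog_le_add_log hx hr]
  have hα : (1 / 2 : ℝ) < 1 := by norm_num
  exact ⟨(locallyIntegrable_of_radial_bounds hα hg.aestronglyMeasurable hrad_low
      hrad_up).locallyIntegrableOn _,
    (bloNorm_le_of_radial_bounds (by norm_num) hα (by norm_num) hg.aestronglyMeasurable hrad_low
      hrad_up).trans_lt ENNReal.ofReal_lt_top⟩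

lemma exp_div_mem_MuckenhouptA1_of_near_posLogLog (hg : Measurable g)
    (hlow : ∀ x, posLogLog x - c ≤ g x) (hup : ∀ x, g x ≤ posLogLog x) {μ : ℝ} (hμ : 0 < μ) :
    (fun x => Real.exp (g x / μ)) ∈ MuckenhouptA1 univ := by
  refine mem_MuckenhouptA1_of_radial_bounds (α := 1 / 2)
    (C := Real.exp (c / μ) * (1 + 2 / μ) ^ (1 / μ))
    (h := fun r => Real.exp ((posLogLog r - c) / μ)) (by norm_num) (by norm_num) (by positivity)
    (hg.div_const μ).exp.aestronglyMeasurable (fun r => Real.exp_pos _) (fun r x hx hr => ?_)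
    fun r x hx hr => ?_
  · gcongr
    linarith [hlow x, posLogLog_le_of_abs_le hx hr]
  · have hexp : Real.exp (posLogLog r / μ) =
        Real.exp (c / μ) * Real.exp ((posLogLog r - c) / μ) := by
      rw [← Real.exp_add, ← add_div, add_sub_cancel]
    calc Real.exp (g x / μ)
        ≤ Real.exp (posLogLog x / μ) := by gcongr; exact hup x
      _ ≤ (1 + 2 / μ) ^ (1 / μ) * Real.exp (posLogLog r / μ) * (r / |x|) ^ (1 / 2 : ℝ) :=
        exp_posLogLog_div_le hμ hx hr
      _ = _ := by rw [hexp]; ring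

lemma posLogLog_mem_TruncApprox : posLogLog ∈ TruncApprox univ := by
  have hlim : Tendsto (fun k : ℕ => ENNReal.ofReal (8 / Real.exp k)) atTop (𝓝 0) := by
    rw [← ENNReal.ofReal_zero]
    exact ENNReal.tendsto_ofReal
      ((Real.tendsto_exp_atTop.comp tendsto_natCast_atTop_atTop).const_div_atTop 8)
  exact ⟨mem_BLO_of_near_posLogLog (c := 0) measurable_posLogLog (fun x => (sub_zero _).le)
      fun x => le_rfl,
    tendsto_of_tendsto_of_tendsto_of_le_of_le tendsto_const_nhds hlim (fun _ => zero_le)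
      bloNorm_posLogLog_sub_trunc_le⟩

lemma mem_closureLinfty_of_near_posLogLog (hg : Measurable g)
    (hlow : ∀ x, posLogLog x - c ≤ g x) (hup : ∀ x, g x ≤ posLogLog x) :
    g ∈ closureLinfty univ := by
  have hdiff : g - posLogLog ∈ Linfty univ :=
    memLp_top_of_bound (hg.sub measurable_posLogLog).aestronglyMeasurable c <| ae_of_all _ fun x =>
      abs_le.2 ⟨le_sub_iff_add_le.2 (by linarith [hlow x]), by
        rw [Pi.sub_apply]
        linarith [hlow x, hup x]⟩
  exact mem_closureLinfty_of_sub_mem_Linfty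
    (TruncApprox_subset_closureLinfty univ posLogLog_mem_TruncApprox)
    (mem_BLO_of_near_posLogLog hg hlow hup) hdiff

end NearPosLogLog

/-! ### The step function -/

lemma natCast_lt_posLogLog_iff (n : ℕ) {x : ℝ} (hx : 0 < x) :
    (n : ℝ) < posLogLog x ↔ x < stepPoint n := by
  have hn : (1 : ℝ) ≤ Real.exp n := Real.one_le_exp n.cast_nonneg
  rw [posLogLog, stepPoint, Real.lt_log_iff_exp_lt (by positivity), lt_max_iff,
    ← Real.log_lt_iff_lt_exp hx, lt_neg]
  exact or_iff_right hn.not_gt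

lemma stepPoint_pos (n : ℕ) : 0 < stepPoint n := Real.exp_pos _

lemma stepPoint_strictAnti : StrictAnti stepPoint := fun _ _ hmn =>
  Real.exp_lt_exp.2 (neg_lt_neg (Real.exp_lt_exp.2 (Nat.cast_lt.2 hmn)))

lemma stepPoint_zero : stepPoint 0 = 1 / Real.exp 1 := by
  rw [stepPoint, Nat.cast_zero, Real.exp_zero, Real.exp_neg, one_div]

lemma Ioo_zero_stepPoint_subset (n : ℕ) : Ioo 0 (stepPoint n) ⊆ baseInterval := by
  rw [baseInterval, ← stepPoint_zero]
  exact Ioo_subset_Ioo_right (stepPoint_strictAnti.antitone n.zero_le)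

lemma stepFun_of_mem_Ico {n : ℕ} {x : ℝ} (hx : x ∈ Ico (stepPoint (n + 1)) (stepPoint n)) :
    stepFun x = n := by
  have hother : ∀ m, m ≠ n → x ∉ Ico (stepPoint (m + 1)) (stepPoint m) := fun m hm hxm =>
    disjoint_left.1 (stepPoint_strictAnti.antitone.pairwise_disjoint_on_Ico_succ hm) hxm hx
  rw [stepFun, tsum_eq_single n fun m hm => by rw [indicator_of_notMem (hother m hm), mul_zero],
    indicator_of_mem hx, mul_one]

/-- The even extension of `stepFun` to the line, namely the largest integer strictly below
`posLogLog`; truncated subtraction gives the value `0` where `posLogLog` vanishes. -/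
noncomputable def posLogLogStep (x : ℝ) : ℝ := ((⌈posLogLog x⌉₊ - 1 : ℕ) : ℝ)

lemma measurable_posLogLogStep : Measurable posLogLogStep :=
  (measurable_from_top (f := fun n : ℕ => ((n - 1 : ℕ) : ℝ))).comp
    (Nat.measurable_ceil.comp measurable_posLogLog)

lemma posLogLog_sub_one_le_posLogLogStep (x : ℝ) : posLogLog x - 1 ≤ posLogLogStep x := by
  rw [posLogLogStep, sub_le_iff_le_add]
  exact_mod_cast (Nat.le_ceil (posLogLog x)).trans (Nat.cast_le.2 le_tsub_add)

lemma posLogLogStep_le_posLogLog (x : ℝ) : posLogLogStep x ≤ posLogLog x := by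
  rw [posLogLogStep]
  rcases Nat.eq_zero_or_pos ⌈posLogLog x⌉₊ with hceil | hceil
  · rw [hceil, zero_tsub, Nat.cast_zero]
    exact posLogLog_nonneg x
  · rw [Nat.cast_pred hceil]
    linarith [Nat.ceil_lt_add_one (posLogLog_nonneg x)]

lemma stepFun_eq_posLogLogStep {x : ℝ} (hx : x ∈ baseInterval) : stepFun x = posLogLogStep x := by
  have hpos : 0 < ⌈posLogLog x⌉₊ := by
    rw [Nat.ceil_pos, ← Nat.cast_zero, natCast_lt_posLogLog_iff 0 hx.1, stepPoint_zero]
    exact hx.2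
  refine stepFun_of_mem_Ico ⟨not_lt.1 ?_, ?_⟩
  · rw [← natCast_lt_posLogLog_iff _ hx.1, Nat.sub_add_cancel hpos, not_lt]
    exact Nat.le_ceil _
  · rw [← natCast_lt_posLogLog_iff _ hx.1, ← Nat.lt_ceil]
    exact Nat.sub_lt hpos one_pos

lemma half_le_bloNorm_stepFun_sub_trunc (k : ℕ) :
    ENNReal.ofReal (1 / 2) ≤ bloNorm baseInterval (stepFun - trunc k stepFun) := by
  set s := stepPoint (k + 1)
  have hlower : stepPoint (k + 2) < s := stepPoint_strictAnti (Nat.lt_succ_self (k + 1))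
  have hupper : s < stepPoint k := stepPoint_strictAnti (Nat.lt_succ_self k)
  obtain ⟨d, hd, hd'⟩ := exists_between (lt_min (sub_pos.2 hlower) (sub_pos.2 hupper))
  obtain ⟨hd_lower, hd_upper⟩ := lt_min_iff.1 hd'
  have hsub : ∀ n : ℕ, EqOn (stepFun - trunc k stepFun) (fun _ => max 0 ((n : ℝ) - k))
      (Ico (stepPoint (n + 1)) (stepPoint n)) := fun n x hx => by
    rw [sub_trunc_apply_of_nonneg k (by rw [stepFun_of_mem_Ico hx]; exact n.cast_nonneg),
      stepFun_of_mem_Ico hx]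
  have hosc := half_jump_le_lowerOsc hd
    ((hsub (k + 1)).mono (Ico_subset_Ico_left (by linarith)))
    ((hsub k).mono (Icc_subset_Ico_right (by linarith)))
  have hI : Icc (s - d) (s + d) ⊆ baseInterval :=
    (Icc_subset_Ioo (by linarith [stepPoint_pos (k + 2)]) (by linarith)).trans
      (Ioo_zero_stepPoint_subset k)
  refine le_trans (le_of_eq ?_) (hosc.trans (lowerOsc_le_bloNorm _ (by linarith) hI))
  simp

lemma stepFun_notMem_TruncApprox : stepFun ∉ TruncApprox baseInterval := fun h => by
  have hle := ge_of_tendsto' h.2 half_le_bloNorm_stepFun_sub_trunc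
  rw [nonpos_iff_eq_zero, ENNReal.ofReal_eq_zero] at hle
  norm_num at hle

lemma logLog_notMem_Linfty : logLog ∉ Linfty baseInterval := fun h => by
  obtain ⟨C, hC⟩ := exists_ae_abs_le_of_mem_Linfty h
  obtain ⟨n, hn⟩ := exists_nat_ge C
  have hsub := Ioo_zero_stepPoint_subset n
  have hfalse : ∀ᵐ _ ∂(volume.restrict (Ioo 0 (stepPoint n))), False := by
    filter_upwards [ae_restrict_of_ae_restrict_of_subset hsub hC, ae_restrict_mem measurableSet_Ioo]
      with x hle hx
    have hlt := (natCast_lt_posLogLog_iff n hx.1).2 hx.2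
    rw [← logLog_eq_posLogLog (hsub hx)] at hlt
    linarith [le_abs_self (logLog x)]
  rw [eventually_false_iff_eq_bot, ae_eq_bot, Measure.restrict_eq_zero, Real.volume_Ioo,
    ENNReal.ofReal_eq_zero] at hfalse
  linarith [stepPoint_pos n]

lemma logLog_ae_eq_posLogLog : logLog =ᵐ[volume.restrict baseInterval] posLogLog :=
  (ae_restrict_mem measurableSet_Ioo).mono fun _ => logLog_eq_posLogLog

lemma stepFun_ae_eq_posLogLogStep : stepFun =ᵐ[volume.restrict baseInterval] posLogLogStep :=
  (ae_restrict_mem measurableSet_Ioo).mono fun _ => stepFun_eq_posLogLogStep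

lemma posLogLogStep_mem_closureLinfty : posLogLogStep ∈ closureLinfty univ :=
  mem_closureLinfty_of_near_posLogLog measurable_posLogLogStep posLogLog_sub_one_le_posLogLogStep
    posLogLogStep_le_posLogLog

end LowerOscillation

theorem mainTheorem3 :
    -- the strict inclusions on the whole line
    (LowerOscillation.Linfty Set.univ ⊂ LowerOscillation.TruncApprox Set.univ ∧
      LowerOscillation.TruncApprox Set.univ ⊂ LowerOscillation.closureLinfty Set.univ) ∧
    -- the strict inclusions on `(0, 1/e)`
    (LowerOscillation.Linfty LowerOscillation.baseInterval ⊂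
        LowerOscillation.TruncApprox LowerOscillation.baseInterval ∧
      LowerOscillation.TruncApprox LowerOscillation.baseInterval ⊂
        LowerOscillation.closureLinfty LowerOscillation.baseInterval) ∧
    -- `log (-log x)` is unbounded and approximable by truncation
    (LowerOscillation.logLog ∉ LowerOscillation.Linfty LowerOscillation.baseInterval ∧
      LowerOscillation.logLog ∈ LowerOscillation.TruncApprox LowerOscillation.baseInterval ∧
      ∀ μ : ℝ, 0 < μ → (fun x => Real.exp (LowerOscillation.logLog x / μ)) ∈
        LowerOscillation.MuckenhouptA1 LowerOscillation.baseInterval) ∧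
    -- the step function is in the closure but not approximable by truncation
    (LowerOscillation.stepFun ∈ LowerOscillation.closureLinfty LowerOscillation.baseInterval ∧
      LowerOscillation.stepFun ∉ LowerOscillation.TruncApprox LowerOscillation.baseInterval ∧
      ∀ μ : ℝ, 0 < μ → (fun x => Real.exp (LowerOscillation.stepFun x / μ)) ∈
        LowerOscillation.MuckenhouptA1 LowerOscillation.baseInterval) := by
  open LowerOscillation in
  have hJ := subset_univ baseInterval
  have hlog := mem_TruncApprox_of_ae_eq hJ logLog_ae_eq_posLogLog posLogLog_mem_TruncApprox
  have hstep :=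
    mem_closureLinfty_of_ae_eq hJ stepFun_ae_eq_posLogLogStep posLogLogStep_mem_closureLinfty
  refine ⟨⟨?_, ?_⟩, ⟨?_, ?_⟩, ⟨logLog_notMem_Linfty, hlog, fun μ hμ => ?_⟩, hstep,
    stepFun_notMem_TruncApprox, fun μ hμ => ?_⟩
  · exact (ssubset_iff_of_subset (Linfty_subset_TruncApprox _)).2 ⟨_, posLogLog_mem_TruncApprox,
      fun h => logLog_notMem_Linfty (mem_Linfty_of_ae_eq hJ logLog_ae_eq_posLogLog h)⟩
  · exact (ssubset_iff_of_subset (TruncApprox_subset_closureLinfty _)).2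
      ⟨_, posLogLogStep_mem_closureLinfty, fun h => stepFun_notMem_TruncApprox
        (mem_TruncApprox_of_ae_eq hJ stepFun_ae_eq_posLogLogStep h)⟩
  · exact (ssubset_iff_of_subset (Linfty_subset_TruncApprox _)).2 ⟨_, hlog, logLog_notMem_Linfty⟩
  · exact (ssubset_iff_of_subset (TruncApprox_subset_closureLinfty _)).2
      ⟨_, hstep, stepFun_notMem_TruncApprox⟩
  · exact mem_MuckenhouptA1_of_ae_eq hJ
      (logLog_ae_eq_posLogLog.fun_comp fun y => Real.exp (y / μ))
      (exp_div_mem_MuckenhouptA1_of_near_posLogLog (c := 0) measurable_posLogLog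
        (fun _ => (sub_zero _).le) (fun _ => le_rfl) hμ)
  · exact mem_MuckenhouptA1_of_ae_eq hJ
      (stepFun_ae_eq_posLogLogStep.fun_comp fun y => Real.exp (y / μ))
      (exp_div_mem_MuckenhouptA1_of_near_posLogLog measurable_posLogLogStep
        posLogLog_sub_one_le_posLogLogStep posLogLogStep_le_posLogLog hμ)
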